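/- Fix constants $c_1,c_2>0$. There is a constant $C>0$, depending only on $c_1$ and $c_2$, such that the following holds. Let $d,k,K$ be non-negative integers with $k\ge c_1 d$. Let $\phi:\mathbb R\to\mathbb R$ be twice differentiable with $|\phi'(z)|\le\Gamma$ and $|\phi''(z)|\le\Gamma$ for all $z\in\mathbb R$. Let $v\in\mathbb R^k$ be a fixed vector half of whose entries equal $1/\sqrt k$ and half of whose entries equal $-1/\sqrt k$ (if $k$ is odd, one entry is $0$ and the remaining $k-1$ entries are split evenly between $\pm1/\sqrt k$), and for $W\in\mathbb R^{k\times d}$, $x\in\mathbb R^d$ let $f(W,x)=v^T\phi(Wx)$, with $\phi$ applied entrywise. Let $c^{(1)},\dots,c^{(K)}\in\mathbb R^d$ be cluster centers of unit Euclidean norm, let $\varepsilon_0\ge 0$, and let $W_0\in\mathbb R^{k\times d}$ be a random matrix with i.i.d. $\mathcal N(0,1)$ entries. Then, with probability at least $1-2e^{-(k+d)}-Ke^{-100d}$ over $W_0$, every matrix $W\in\mathbb R^{k\times d}$ with $\|W-W_0\|_F\le c_2\sqrt k$ satisfies, for all $1\le i\le K$, $$\sup_{\|x-c^{(i)}\|_2\le\varepsilon_0,\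 \|\tilde x-c^{(i)}\|_2\le\varepsilon_0}|f(W,x)-f(W,\tilde x)|\le C\,\Gamma\,\varepsilon_0\,\bigl(\|W-W_0\|+\sqrt d\bigr),$$ where $\|\cdot\|_F$ is the Frobenius norm of a matrix and $\|\cdot\|$ is its spectral norm (largest singular value). -/

import Mathlib

open MeasureTheory ProbabilityTheory
open scoped Matrix

namespace ShallowNet

noncomputable section

/-- The spectral norm (largest singular value) of a real matrix, i.e. the operator norm
with respect to the Euclidean norms. -/
def spectralNorm {k d : ℕ} (A : Matrix (Fin k) (Fin d) ℝ) : ℝ :=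
  Matrix.instL2OpNormedAddCommGroup.toNorm.norm A

/-- The Frobenius norm of a real matrix. -/
def frobeniusNorm {k d : ℕ} (A : Matrix (Fin k) (Fin d) ℝ) : ℝ :=
  Matrix.frobeniusNormedAddCommGroup.toNorm.norm A

/-- The fixed output weights: half of the entries equal `1/√k`, the other half equal `-1/√k`;
if `k` is odd, the one remaining entry is zero. -/
structure IsBalancedOutput {k : ℕ} (v : Fin k → ℝ) : Prop where
  card_pos : (Finset.univ.filter fun l => v l = 1 / √(k : ℝ)).card = k / 2
  card_neg : (Finset.univ.filter fun l => v l = -(1 / √(k : ℝ))).card = k / 2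
  eq_zero : ∀ l, v l ≠ 1 / √(k : ℝ) → v l ≠ -(1 / √(k : ℝ)) → v l = 0

/-- The one-hidden-layer network `f(W, x) = vᵀ φ(W x)`, with `φ` applied entrywise. -/
def network {k d : ℕ} (φ : ℝ → ℝ) (v : Fin k → ℝ) (W : Matrix (Fin k) (Fin d) ℝ)
    (x : EuclideanSpace ℝ (Fin d)) : ℝ :=
  v ⬝ᵥ fun l => φ ((W *ᵥ x.ofLp) l)

/-- The entries of the random matrix `W₀` are independent standard normal variables. -/
structure IsGaussianMatrix {Ω : Type*} [MeasurableSpace Ω] {k d : ℕ}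
    (W₀ : Ω → Matrix (Fin k) (Fin d) ℝ) (P : Measure Ω) : Prop where
  hasLaw : ∀ l j, HasLaw (fun ω => W₀ ω l j) (gaussianReal 0 1) P
  indep : iIndepFun (fun (p : Fin k × Fin d) ω => W₀ ω p.1 p.2) P

end

end ShallowNet

/-! Write `D = W - W₀` and split the variation of `f(W, ·)` into its variation at `W₀` plus the
variation of `f(W₀ + D, ·) - f(W₀, ·)`.

At `W₀`, an increment is `∑ l, v l * Y (w l)` over independent Gaussian rows, with `Y g = φ(g·x) -
φ(g·x')` and `|Y g| ≤ Γ |g·(x - x')|`. `Y` need not be centred, but the weights `±1/√k` occur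
equally often, so rows pair up into differences of independent copies. The increment is therefore
sub-Gaussian with parameter `Γ² ‖x - x'‖²`, free of `k` (`IsBalancedOutput.hasSubgaussianMGF`).
Chaining over a ball of radius `ε` in dimension `d` gives `O(Γ ε √d)` with failure probability
`exp(-100 d)` per centre.

The second part is deterministic once `‖W₀‖ = O(√k)`, which a net argument and `d ≤ k / c₁` supply
outside probability `exp(-(k + d))`. Bounds on both derivatives of `φ` control a second difference
in each row; Cauchy–Schwarz over the rows costs `√k`, which the weights `1/√k` cancel
(`abs_network_perturbed_sub_le`). -/

namespace ShallowNet

/-! ### Gaussian matrices and exponential moments of linear forms -/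

/-- The standard Gaussian measure on `Fin d → ℝ`. -/
noncomputable abbrev gaussianRow (d : ℕ) : Measure (Fin d → ℝ) :=
  Measure.pi fun _ => gaussianReal 0 1

/-- The law of a `k × d` matrix with independent standard Gaussian entries. -/
noncomputable abbrev gaussianMatrix (k d : ℕ) : Measure (Fin k → Fin d → ℝ) :=
  Measure.pi fun _ => gaussianRow d

lemma IsGaussianMatrix.map_eq {Ω : Type*} [MeasurableSpace Ω] {P : Measure Ω}
    [IsProbabilityMeasure P] {k d : ℕ} {W₀ : Ω → Matrix (Fin k) (Fin d) ℝ}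
    (h : IsGaussianMatrix W₀ P) :
    AEMeasurable (fun ω l j => W₀ ω l j) P ∧
      P.map (fun ω l j => W₀ ω l j) = gaussianMatrix k d := by
  have hm : ∀ p : Fin k × Fin d, AEMeasurable (fun ω => W₀ ω p.1 p.2) P := fun p =>
    (h.hasLaw p.1 p.2).aemeasurable
  refine ⟨aemeasurable_pi_lambda _ fun l => aemeasurable_pi_lambda _ fun j => hm (l, j), ?_⟩
  have h1 := (iIndepFun_iff_map_fun_eq_pi_map hm).1 h.indep
  simp only [fun p : Fin k × Fin d => (h.hasLaw p.1 p.2).map_eq] at h1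
  have h2 : (fun ω l j => W₀ ω l j) =
      MeasurableEquiv.curry (Fin k) (Fin d) ℝ ∘ fun ω (p : Fin k × Fin d) => W₀ ω p.1 p.2 := rfl
  rw [h2, ← AEMeasurable.map_map_of_aemeasurable
    (MeasurableEquiv.curry (Fin k) (Fin d) ℝ).measurable.aemeasurable
    (aemeasurable_pi_lambda _ hm), h1]
  have h3 := Measure.infinitePi_map_curry (ι := Fin k) (κ := Fin d) (X := ℝ)
    (fun _ _ => gaussianReal 0 1)
  simpa only [Measure.infinitePi_eq_pi] using h3

lemma integrable_exp_dotProduct {d : ℕ} (x : Fin d → ℝ) (s : ℝ) :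
    Integrable (fun g : Fin d → ℝ => Real.exp (s * (g ⬝ᵥ x))) (gaussianRow d) := by
  have h : (fun g : Fin d → ℝ => Real.exp (s * (g ⬝ᵥ x))) =
      fun g => ∏ j, Real.exp (s * x j * g j) := by
    ext g
    rw [← Real.exp_sum, dotProduct, Finset.mul_sum]
    congr 1; exact Finset.sum_congr rfl fun j _ => by ring
  rw [h]
  exact Integrable.fintype_prod (f := fun j (t : ℝ) => Real.exp (s * x j * t))
    fun j => integrable_exp_mul_gaussianReal _

lemma integral_exp_dotProduct {d : ℕ} (x : Fin d → ℝ) (s : ℝ) :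
    ∫ g : Fin d → ℝ, Real.exp (s * (g ⬝ᵥ x)) ∂(gaussianRow d) =
      Real.exp (s ^ 2 * (x ⬝ᵥ x) / 2) := by
  have h : (fun g : Fin d → ℝ => Real.exp (s * (g ⬝ᵥ x))) =
      fun g => ∏ j, Real.exp (s * x j * g j) := by
    ext g
    rw [← Real.exp_sum, dotProduct, Finset.mul_sum]
    congr 1; exact Finset.sum_congr rfl fun j _ => by ring
  have h1 : ∀ t : ℝ, ∫ y, Real.exp (t * y) ∂(gaussianReal 0 1) = Real.exp (t ^ 2 / 2) := by
    intro t
    have := congrFun (mgf_fun_id_gaussianReal (μ := 0) (v := 1)) t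
    simpa [mgf] using this
  rw [h, integral_fintype_prod_eq_prod (f := fun j (t : ℝ) => Real.exp (s * x j * t))]
  simp only [h1]
  rw [← Real.exp_sum, dotProduct, Finset.mul_sum, Finset.sum_div]
  congr 1; exact Finset.sum_congr rfl fun j _ => by ring

/-! ### Sub-Gaussian sums over Gaussian rows -/

section Row

variable {d : ℕ} {x : Fin d → ℝ} {b : ℝ} {Y : (Fin d → ℝ) → ℝ}

lemma integrable_exp_of_abs_le_dotProduct (hY : Measurable Y)
    (hb : ∀ g, |Y g| ≤ b * |g ⬝ᵥ x|) (s : ℝ) :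
    Integrable (fun g => Real.exp (s * Y g)) (gaussianRow d) := by
  refine ((integrable_exp_dotProduct x (|s| * b)).add
    (integrable_exp_dotProduct x (-(|s| * b)))).mono'
    (by fun_prop) (ae_of_all _ fun g => ?_)
  rw [Real.norm_eq_abs, Real.abs_exp]
  have h1 : s * Y g ≤ |s| * b * |g ⬝ᵥ x| := by
    calc s * Y g ≤ |s * Y g| := le_abs_self _
      _ = |s| * |Y g| := abs_mul _ _
      _ ≤ |s| * (b * |g ⬝ᵥ x|) := by gcongr; exact hb g
      _ = _ := by ring
  simp only [Pi.add_apply]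
  rcases abs_cases (g ⬝ᵥ x) with ⟨h, _⟩ | ⟨h, _⟩ <;> rw [h] at h1
  · exact (Real.exp_le_exp.2 h1).trans (le_add_of_nonneg_right (Real.exp_pos _).le)
  · refine (Real.exp_le_exp.2 (h1.trans_eq ?_)).trans
      (le_add_of_nonneg_left (Real.exp_pos _).le)
    ring

/-- A variable dominated by a centred Gaussian variable, minus an independent copy of itself,
has a Gaussian moment generating function bound; no centring is needed. -/
lemma integral_exp_mul_integral_exp_neg_le (hY : Measurable Y)
    (hb : ∀ g, |Y g| ≤ b * |g ⬝ᵥ x|) (s : ℝ) :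
    (∫ g, Real.exp (s * Y g) ∂(gaussianRow d)) * (∫ g, Real.exp (-s * Y g) ∂(gaussianRow d)) ≤
      Real.exp (s ^ 2 * (b ^ 2 * (x ⬝ᵥ x))) := by
  set A := ∫ g, Real.exp (s * Y g) ∂(gaussianRow d)
  set B := ∫ g, Real.exp (-s * Y g) ∂(gaussianRow d)
  have iA := integrable_exp_of_abs_le_dotProduct hY hb s
  have iB := integrable_exp_of_abs_le_dotProduct hY hb (-s)
  have jA := integrable_exp_dotProduct x (s * b)
  have jB := integrable_exp_dotProduct x (-(s * b))
  have hA : 0 ≤ A := integral_nonneg fun _ => (Real.exp_pos _).le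
  have hB : 0 ≤ B := integral_nonneg fun _ => (Real.exp_pos _).le
  -- `exp y + exp (-y) = 2 cosh y` is monotone in `|y|`, so `Y` may be replaced by the dominating
  -- Gaussian. The product is then bounded by `4AB ≤ (A + B)²`.
  have key : A + B ≤ 2 * Real.exp ((s * b) ^ 2 * (x ⬝ᵥ x) / 2) := by
    calc A + B = ∫ g, (Real.exp (s * Y g) + Real.exp (-s * Y g)) ∂(gaussianRow d) :=
          (integral_add iA iB).symm
      _ ≤ ∫ g, (Real.exp (s * b * (g ⬝ᵥ x)) + Real.exp (-(s * b) * (g ⬝ᵥ x)))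
            ∂(gaussianRow d) := by
          refine integral_mono (iA.add iB) (jA.add jB) fun g => ?_
          have h1 : |s * Y g| ≤ |s * b * (g ⬝ᵥ x)| := by
            rw [abs_mul, abs_mul, abs_mul, mul_assoc]
            refine mul_le_mul_of_nonneg_left ((hb g).trans ?_) (abs_nonneg _)
            exact mul_le_mul_of_nonneg_right (le_abs_self _) (abs_nonneg _)
          have h2 := Real.cosh_le_cosh.2 h1
          rw [Real.cosh_eq, Real.cosh_eq] at h2
          simp only [neg_mul]
          linarith
      _ = _ := by
          rw [integral_add jA jB, integral_exp_dotProduct, integral_exp_dotProduct]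
          ring_nf
  have h4 : (2 * Real.exp ((s * b) ^ 2 * (x ⬝ᵥ x) / 2)) ^ 2 =
      4 * Real.exp (s ^ 2 * (b ^ 2 * (x ⬝ᵥ x))) := by
    rw [mul_pow, ← Real.exp_nat_mul]; norm_num; ring_nf
  nlinarith [sq_nonneg (A - B), pow_le_pow_left₀ (add_nonneg hA hB) key 2]

end Row

/-- Pairs the positive weights with the negative ones; `f 0 = 1` makes the leftover coordinate for
odd `k` harmless. -/
lemma IsBalancedOutput.prod_eq {k : ℕ} {v : Fin k → ℝ} (hv : IsBalancedOutput v) {f : ℝ → ℝ}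
    (h0 : f 0 = 1) :
    ∏ l, f (v l) = (f (1 / √(k : ℝ)) * f (-(1 / √(k : ℝ)))) ^ (k / 2) := by
  have h : ∀ l, f (v l) = (if v l = 1 / √(k : ℝ) then f (1 / √(k : ℝ)) else 1) *
      (if v l = -(1 / √(k : ℝ)) then f (-(1 / √(k : ℝ))) else 1) := by
    intro l
    have hk : 0 < 1 / √(k : ℝ) := by
      have : (0 : ℝ) < k := by exact_mod_cast l.pos
      positivity
    by_cases h1 : v l = 1 / √(k : ℝ)
    · have : v l ≠ -(1 / √(k : ℝ)) := by rw [h1]; linarith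
      rw [if_pos h1, if_neg this, mul_one, h1]
    · by_cases h2 : v l = -(1 / √(k : ℝ))
      · rw [if_neg h1, if_pos h2, one_mul, h2]
      · rw [if_neg h1, if_neg h2, hv.eq_zero l h1 h2, h0, one_mul]
  rw [Finset.prod_congr rfl fun l _ => h l, Finset.prod_mul_distrib, Finset.prod_ite,
    Finset.prod_ite, Finset.prod_const_one, Finset.prod_const_one, Finset.prod_const,
    Finset.prod_const, hv.card_pos, hv.card_neg, mul_one, mul_one, mul_pow]

/-- The generating function factors over rows into `k / 2` pairs, each at most `exp (t² c / k)`, so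
the dependence on `k` cancels. -/
lemma IsBalancedOutput.hasSubgaussianMGF {k d : ℕ} {v : Fin k → ℝ} (hv : IsBalancedOutput v)
    {x : Fin d → ℝ} {b : ℝ} {Y : (Fin d → ℝ) → ℝ} (hY : Measurable Y)
    (hb : ∀ g, |Y g| ≤ b * |g ⬝ᵥ x|) {c : NNReal} (hc : b ^ 2 * (x ⬝ᵥ x) ≤ c) :
    HasSubgaussianMGF (fun w : Fin k → Fin d → ℝ => ∑ l, v l * Y (w l)) c
      (gaussianMatrix k d) := by
  have h : ∀ t : ℝ, (fun w : Fin k → Fin d → ℝ => Real.exp (t * ∑ l, v l * Y (w l))) =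
      fun w => ∏ l, Real.exp (t * v l * Y (w l)) := by
    intro t; ext w
    rw [← Real.exp_sum, Finset.mul_sum]
    congr 1; exact Finset.sum_congr rfl fun j _ => by ring
  refine ⟨fun t => ?_, fun t => ?_⟩
  · rw [h]
    exact Integrable.fintype_prod (f := fun l g => Real.exp (t * v l * Y g))
      fun l => integrable_exp_of_abs_le_dotProduct hY hb _
  · rw [mgf, h, integral_fintype_prod_eq_prod (f := fun l g => Real.exp (t * v l * Y g)),
      hv.prod_eq (f := fun a => ∫ g, Real.exp (t * a * Y g) ∂(gaussianRow d)) (by simp)]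
    have hx : 0 ≤ x ⬝ᵥ x := Finset.sum_nonneg fun i _ => mul_self_nonneg _
    have h1 := integral_exp_mul_integral_exp_neg_le hY hb (t * (1 / √(k : ℝ)))
    have h2 : t * -(1 / √(k : ℝ)) = -(t * (1 / √(k : ℝ))) := by ring
    rw [h2]
    refine (pow_le_pow_left₀ ?_ h1 _).trans ?_
    · exact mul_nonneg (integral_nonneg fun _ => (Real.exp_pos _).le)
        (integral_nonneg fun _ => (Real.exp_pos _).le)
    · rw [← Real.exp_nat_mul, Real.exp_le_exp]
      have h3 : ((k / 2 : ℕ) : ℝ) ≤ k / 2 := by exact_mod_cast Nat.cast_div_le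
      rcases Nat.eq_zero_or_pos k with rfl | hk
      · simp; positivity
      have hk' : (0 : ℝ) < k := by exact_mod_cast hk
      calc ((k / 2 : ℕ) : ℝ) * ((t * (1 / √(k : ℝ))) ^ 2 * (b ^ 2 * (x ⬝ᵥ x)))
          ≤ (k / 2) * ((t * (1 / √(k : ℝ))) ^ 2 * c) := by gcongr
        _ = c * t ^ 2 / 2 := by
          rw [mul_pow, div_pow, Real.sq_sqrt hk'.le]; field_simp

lemma hasSubgaussianMGF_bilinear {k d : ℕ} {a : Fin k → ℝ} {x : Fin d → ℝ}
    (ha : a ⬝ᵥ a ≤ 1) (hx : x ⬝ᵥ x ≤ 1) :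
    HasSubgaussianMGF (fun w : Fin k → Fin d → ℝ => ∑ l, a l * (w l ⬝ᵥ x)) 1
      (gaussianMatrix k d) := by
  have h : ∀ t : ℝ, (fun w : Fin k → Fin d → ℝ => Real.exp (t * ∑ l, a l * (w l ⬝ᵥ x))) =
      fun w => ∏ l, Real.exp (t * a l * (w l ⬝ᵥ x)) := by
    intro t; ext w
    rw [← Real.exp_sum, Finset.mul_sum]
    congr 1; exact Finset.sum_congr rfl fun j _ => by ring
  refine ⟨fun t => ?_, fun t => ?_⟩
  · rw [h]
    exact Integrable.fintype_prod (f := fun l g => Real.exp (t * a l * (g ⬝ᵥ x)))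
      fun l => integrable_exp_dotProduct _ _
  · rw [mgf, h, integral_fintype_prod_eq_prod (f := fun l g => Real.exp (t * a l * (g ⬝ᵥ x)))]
    simp only [integral_exp_dotProduct]
    rw [← Real.exp_sum, Real.exp_le_exp]
    have h1 : ∑ l, (t * a l) ^ 2 * (x ⬝ᵥ x) / 2 = t ^ 2 * ((a ⬝ᵥ a) * (x ⬝ᵥ x)) / 2 := by
      rw [show a ⬝ᵥ a = ∑ l, a l * a l from rfl, Finset.sum_mul, Finset.mul_sum, Finset.sum_div]
      exact Finset.sum_congr rfl fun l _ => by ring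
    have hx0 : 0 ≤ x ⬝ᵥ x := Finset.sum_nonneg fun i _ => mul_self_nonneg _
    have ha0 : 0 ≤ a ⬝ᵥ a := Finset.sum_nonneg fun i _ => mul_self_nonneg _
    rw [h1]
    have := mul_le_one₀ ha hx0 hx
    simp only [NNReal.coe_one, one_mul]
    nlinarith [sq_nonneg t]

/-! ### Nets and chaining in the unit ball -/

section Net

variable {E : Type*} [NormedAddCommGroup E] [NormedSpace ℝ E]

variable (E) in
/-- The unit ball of a finite-dimensional space has a `1/2`-net with at most `5 ^ dim` points. -/
lemma exists_half_net [FiniteDimensional ℝ E] :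
    ∃ N : Finset E, N.card ≤ 5 ^ Module.finrank ℝ E ∧ (∀ n ∈ N, ‖n‖ ≤ 1) ∧
      ∀ u : E, ‖u‖ ≤ 1 → ∃ n ∈ N, ‖u - n‖ ≤ 1 / 2 := by
  classical
  let S : Set ℕ := {m | ∃ s : Finset E, s.card = m ∧ (∀ c ∈ s, ‖c‖ ≤ 2) ∧
    ∀ c ∈ s, ∀ d ∈ s, c ≠ d → 1 ≤ ‖c - d‖}
  have hbd : BddAbove S := ⟨5 ^ Module.finrank ℝ E, by
    rintro m ⟨s, rfl, h1, h2⟩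
    exact Besicovitch.card_le_of_separated s h1 h2⟩
  have hne : S.Nonempty := ⟨0, ∅, by simp⟩
  -- A 1-separated subset of the ball of radius 2 of maximal cardinality; halved, it is the net,
  -- since an uncovered `u` would allow `2 • u` to be added.
  obtain ⟨s, hs, h1, h2⟩ := Nat.sSup_mem hne hbd
  refine ⟨s.image fun c => (1 / 2 : ℝ) • c, ?_, ?_, fun u hu => ?_⟩
  · exact Finset.card_image_le.trans (Besicovitch.card_le_of_separated s h1 h2)
  · intro n hn
    obtain ⟨c, hc, rfl⟩ := Finset.mem_image.1 hn
    rw [norm_smul]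
    have := h1 c hc
    norm_num
    linarith
  · by_contra! hcon
    have hfar : ∀ c ∈ s, 1 ≤ ‖(2 : ℝ) • u - c‖ := by
      intro c hc
      have h3 := hcon _ (Finset.mem_image_of_mem _ hc)
      have h4 : (2 : ℝ) • u - c = (2 : ℝ) • (u - (1 / 2 : ℝ) • c) := by
        rw [smul_sub, smul_smul]; norm_num
      rw [h4, norm_smul]
      norm_num at h3 ⊢
      linarith
    have hnot : (2 : ℝ) • u ∉ s := fun hmem => by
      have := hfar _ hmem
      simp at this
      linarith
    have hmem : s.card + 1 ∈ S := by
      refine ⟨insert ((2 : ℝ) • u) s, Finset.card_insert_of_notMem hnot, ?_, ?_⟩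
      · intro c hc
        rcases Finset.mem_insert.1 hc with rfl | hc
        · rw [norm_smul]; norm_num; linarith
        · exact h1 c hc
      · intro c hc e he hce
        rcases Finset.mem_insert.1 hc with rfl | hc <;> rcases Finset.mem_insert.1 he with rfl | he
        · exact absurd rfl hce
        · exact hfar e he
        · rw [norm_sub_rev]; exact hfar c hc
        · exact h2 c hc e he hce
    have := le_csSup hbd hmem
    omega

open Classical in
/-- Partial sums `∑_{i < j} 2⁻ⁱ nᵢ` with digits `nᵢ` in a finite set. -/
noncomputable def digitSums (N : Finset E) : ℕ → Finset E
  | 0 => {0}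
  | j + 1 => (digitSums N j ×ˢ N).image fun p => p.1 + ((1 / 2 : ℝ) ^ j) • p.2

lemma card_digitSums_le (N : Finset E) (j : ℕ) : (digitSums N j).card ≤ N.card ^ j := by
  classical
  induction j with
  | zero => simp [digitSums]
  | succ j ih =>
    refine Finset.card_image_le.trans ?_
    rw [Finset.card_product, pow_succ]
    exact Nat.mul_le_mul_right _ ih

/-- Chaining: a continuous function whose increments along the digit sums are small is close on
the whole unit ball to its value at the origin. -/
lemma abs_sub_le_of_digitSums {N : Finset E}
    (hN : ∀ u : E, ‖u‖ ≤ 1 → ∃ n ∈ N, ‖u - n‖ ≤ 1 / 2) {F : E → ℝ} (hF : Continuous F)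
    {τ : ℝ} (hτ : 0 ≤ τ)
    (h : ∀ j, ∀ p ∈ digitSums N j, ∀ n ∈ N,
      |F (p + ((1 / 2 : ℝ) ^ j) • n) - F p| ≤ τ * (3 / 4) ^ j)
    {u : E} (hu : ‖u‖ ≤ 1) : |F u - F 0| ≤ 4 * τ := by
  classical
  have hpath : ∀ j : ℕ, ∃ p ∈ digitSums N j, ‖u - p‖ ≤ (1 / 2 : ℝ) ^ j ∧
      |F p - F 0| ≤ 4 * τ * (1 - (3 / 4) ^ j) := by
    intro j
    induction j with
    | zero => exact ⟨0, by simp [digitSums], by simpa using hu, by simp⟩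
    | succ j ih =>
      obtain ⟨p, hp, hup, hFp⟩ := ih
      have h2 : (0 : ℝ) < (1 / 2) ^ j := by positivity
      -- The next digit approximates the residual rescaled to the unit ball, which halves the error.
      obtain ⟨n, hn, hun⟩ := hN (((1 / 2 : ℝ) ^ j)⁻¹ • (u - p)) (by
        rw [norm_smul, Real.norm_eq_abs, abs_of_pos (inv_pos.2 h2), inv_mul_le_iff₀ h2, mul_one]
        exact hup)
      refine ⟨p + ((1 / 2 : ℝ) ^ j) • n, ?_, ?_, ?_⟩
      · exact Finset.mem_image.2 ⟨(p, n), Finset.mk_mem_product hp hn, rfl⟩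
      · have h3 : u - (p + ((1 / 2 : ℝ) ^ j) • n) =
            ((1 / 2 : ℝ) ^ j) • (((1 / 2 : ℝ) ^ j)⁻¹ • (u - p) - n) := by
          rw [smul_sub, smul_smul, mul_inv_cancel₀ h2.ne', one_smul]; abel
        rw [h3, norm_smul, Real.norm_eq_abs, abs_of_pos h2, pow_succ]
        gcongr
      · have h4 := h j p hp n hn
        have h5 := abs_sub_le (F (p + ((1 / 2 : ℝ) ^ j) • n)) (F p) (F 0)
        calc _ ≤ _ := h5
          _ ≤ τ * (3 / 4) ^ j + 4 * τ * (1 - (3 / 4) ^ j) := add_le_add h4 hFp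
          _ = _ := by ring
  choose p _ hup hFp using hpath
  have hlim : Filter.Tendsto p Filter.atTop (nhds u) := by
    rw [tendsto_iff_norm_sub_tendsto_zero]
    refine squeeze_zero (fun _ => norm_nonneg _) (fun j => ?_)
      (tendsto_pow_atTop_nhds_zero_of_lt_one (r := (1 / 2 : ℝ)) (by norm_num) (by norm_num))
    rw [norm_sub_rev]; exact hup j
  refine le_of_tendsto' ((((hF.tendsto u).comp hlim).sub_const (F 0)).abs) fun j => ?_
  refine (hFp j).trans ?_
  have : (0 : ℝ) ≤ (3 / 4) ^ j := by positivity
  nlinarith [mul_nonneg hτ this]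

end Net

/-! ### Tail bounds for sub-Gaussian processes -/

/-- Two-sided tail bound for a sub-Gaussian random variable. -/
lemma measureReal_abs_gt_le {Ω : Type*} [MeasurableSpace Ω] {μ : Measure Ω}
    [IsProbabilityMeasure μ] {X : Ω → ℝ} {c : NNReal} (h : HasSubgaussianMGF X c μ)
    {t : ℝ} (ht : 0 ≤ t) :
    μ.real {ω | t < |X ω|} ≤ 2 * Real.exp (-t ^ 2 / (2 * c)) := by
  have h1 := h.measure_ge_le ht
  have h2 := h.neg.measure_ge_le ht
  have hsub : {ω | t < |X ω|} ⊆ {ω | t ≤ X ω} ∪ {ω | t ≤ (-X) ω} := by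
    intro ω hω
    rcases lt_abs.1 (show t < |X ω| from hω) with h | h
    · exact Or.inl h.le
    · exact Or.inr h.le
  calc _ ≤ _ := measureReal_mono hsub
    _ ≤ _ := measureReal_union_le _ _
    _ ≤ _ := by linarith

/-- Uniform bound on the unit ball for a continuous process with sub-Gaussian increments. -/
lemma measureReal_exists_abs_sub_gt_le {Ω : Type*} [MeasurableSpace Ω] {μ : Measure Ω}
    [IsProbabilityMeasure μ] {d : ℕ} (hd : 0 < d) {X : EuclideanSpace ℝ (Fin d) → Ω → ℝ}
    (hX : ∀ ω, Continuous fun u => X u ω) {b : ℝ} (hb : 0 < b)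
    (h : ∀ (u u' : EuclideanSpace ℝ (Fin d)) (c : NNReal), (b * ‖u - u'‖) ^ 2 ≤ c →
      HasSubgaussianMGF (fun ω => X u ω - X u' ω) c μ) :
    μ.real {ω | ∃ u : EuclideanSpace ℝ (Fin d), ‖u‖ ≤ 1 ∧ 80 * (b * √(d : ℝ)) < |X u ω - X 0 ω|}
      ≤ Real.exp (-(100 * (d : ℝ))) := by
  obtain ⟨N, hcard, hN1, hN⟩ := exists_half_net (EuclideanSpace ℝ (Fin d))
  rw [finrank_euclideanSpace_fin] at hcard
  have hd1 : (1 : ℝ) ≤ d := by exact_mod_cast hd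
  set τ : ℝ := 20 * (b * √(d : ℝ)) with hτ
  have hτ0 : 0 ≤ τ := by positivity
  -- Steps shrink like `2⁻ʲ` but thresholds only like `(3/4)ʲ`: these still sum to `4τ`, while the
  -- tail exponent `200 d (9/4)ʲ` outgrows the entropy `2 d (j + 1)`.
  let B : ℕ → Set Ω := fun j => ⋃ q ∈ digitSums N j ×ˢ N,
    {ω | τ * (3 / 4) ^ j < |X (q.1 + ((1 / 2 : ℝ) ^ j) • q.2) ω - X q.1 ω|}
  have hsub : {ω | ∃ u : EuclideanSpace ℝ (Fin d), ‖u‖ ≤ 1 ∧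
      80 * (b * √(d : ℝ)) < |X u ω - X 0 ω|} ⊆ ⋃ j, B j := by
    rintro ω ⟨u, hu, hlt⟩
    by_contra hcon
    simp only [B, Set.mem_iUnion, Set.mem_ofPred_eq, not_exists, not_lt, Finset.mem_product] at hcon
    have := abs_sub_le_of_digitSums hN (hX ω) hτ0
      (fun j p hp n hn => hcon j (p, n) ⟨hp, hn⟩) hu
    rw [hτ] at this
    linarith
  have hBj : ∀ j, μ.real (B j) ≤ Real.exp (-(100 * (d : ℝ))) * (1 / 2) * (1 / 2) ^ j := by
    intro j
    have hone : ∀ q ∈ digitSums N j ×ˢ N,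
        μ.real {ω | τ * (3 / 4) ^ j < |X (q.1 + ((1 / 2 : ℝ) ^ j) • q.2) ω - X q.1 ω|} ≤
          2 * Real.exp (-(200 * d * (9 / 4) ^ j)) := by
      intro q hq
      have hc := h (q.1 + ((1 / 2 : ℝ) ^ j) • q.2) q.1 ⟨(b * (1 / 2) ^ j) ^ 2, by positivity⟩ (by
        change _ ≤ (b * (1 / 2) ^ j) ^ 2
        rw [add_sub_cancel_left, norm_smul, Real.norm_eq_abs, abs_of_pos (by positivity)]
        have := hN1 q.2 (Finset.mem_product.1 hq).2
        gcongr
        exact mul_le_of_le_one_right (by positivity) this)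
      refine (measureReal_abs_gt_le hc (by positivity)).trans_eq ?_
      congr 2
      change -(τ * (3 / 4) ^ j) ^ 2 / (2 * (b * (1 / 2) ^ j) ^ 2) = _
      have h94 : (9 / 4 : ℝ) ^ j * ((1 / 2) ^ j) ^ 2 = ((3 / 4) ^ j) ^ 2 := by
        rw [← pow_mul, ← pow_mul, mul_comm j 2, pow_mul, pow_mul, ← mul_pow]; norm_num
      rw [div_eq_iff (by positivity), hτ]
      simp only [mul_pow]
      rw [← h94, Real.sq_sqrt (by positivity)]
      ring
    have hcount : ((digitSums N j ×ˢ N).card : ℝ) ≤ Real.exp (2 * d * (j + 1)) := by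
      have h1 : (digitSums N j ×ˢ N).card ≤ 5 ^ (d * (j + 1)) := by
        rw [Finset.card_product, pow_mul]
        calc _ ≤ N.card ^ j * N.card := Nat.mul_le_mul_right _ (card_digitSums_le N j)
          _ = N.card ^ (j + 1) := (pow_succ _ _).symm
          _ ≤ _ := Nat.pow_le_pow_left hcard _
      have h5 : (5 : ℝ) ≤ Real.exp 2 := by
        have := Real.quadratic_le_exp_of_nonneg (x := 2) (by norm_num)
        linarith
      calc ((digitSums N j ×ˢ N).card : ℝ) ≤ (5 : ℝ) ^ (d * (j + 1)) := by exact_mod_cast h1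
        _ ≤ Real.exp 2 ^ (d * (j + 1)) := by gcongr
        _ = _ := by rw [← Real.exp_nat_mul]; push_cast; ring_nf
    have hhalf : Real.exp (-1) ≤ 1 / 2 := by
      rw [Real.exp_neg, one_div]
      gcongr
      have := Real.add_one_le_exp (1 : ℝ)
      linarith
    have htwo : (2 : ℝ) ≤ Real.exp 1 := by
      have := Real.add_one_le_exp (1 : ℝ)
      linarith
    have hbern : (1 : ℝ) + j ≤ (9 / 4) ^ j := by
      have := one_add_mul_le_pow (a := (5 / 4 : ℝ)) (by norm_num) j
      have hj : (0 : ℝ) ≤ j := by positivity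
      norm_num at this
      linarith
    calc μ.real (B j) ≤ ∑ q ∈ digitSums N j ×ˢ N, μ.real
          {ω | τ * (3 / 4) ^ j < |X (q.1 + ((1 / 2 : ℝ) ^ j) • q.2) ω - X q.1 ω|} :=
          measureReal_biUnion_finset_le _ _
      _ ≤ ∑ q ∈ digitSums N j ×ˢ N, 2 * Real.exp (-(200 * d * (9 / 4) ^ j)) :=
          Finset.sum_le_sum hone
      _ = (digitSums N j ×ˢ N).card * (2 * Real.exp (-(200 * d * (9 / 4) ^ j))) := by
          rw [Finset.sum_const, nsmul_eq_mul]
      _ ≤ Real.exp (2 * d * (j + 1)) * (Real.exp 1 * Real.exp (-(200 * d * (9 / 4) ^ j))) := by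
          gcongr
      _ ≤ Real.exp (-(100 * (d : ℝ))) * Real.exp (-1) * Real.exp (-1) ^ j := by
          rw [← Real.exp_nat_mul, ← Real.exp_add, ← Real.exp_add, ← Real.exp_add, ← Real.exp_add,
            Real.exp_le_exp]
          have hj : (0 : ℝ) ≤ j := by positivity
          have h1 := mul_le_mul_of_nonneg_left hbern (by positivity : (0 : ℝ) ≤ 200 * d)
          nlinarith [mul_nonneg hj (by linarith : (0 : ℝ) ≤ d - 1)]
      _ ≤ _ := by gcongr
  have hsum : HasSum (fun j : ℕ => Real.exp (-(100 * (d : ℝ))) * (1 / 2) * (1 / 2) ^ j)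
      (Real.exp (-(100 * (d : ℝ)))) := by
    have := hasSum_geometric_two.mul_left (Real.exp (-(100 * (d : ℝ))) * (1 / 2))
    rwa [show Real.exp (-(100 * (d : ℝ))) * (1 / 2) * 2 = Real.exp (-(100 * (d : ℝ))) by ring]
      at this
  rw [measureReal_def]
  refine ENNReal.toReal_le_of_le_ofReal (Real.exp_pos _).le ?_
  calc μ _ ≤ μ (⋃ j, B j) := measure_mono hsub
    _ ≤ ∑' j, μ (B j) := measure_iUnion_le _
    _ ≤ ∑' j : ℕ, ENNReal.ofReal (Real.exp (-(100 * (d : ℝ))) * (1 / 2) * (1 / 2) ^ j) := by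
        refine ENNReal.tsum_le_tsum fun j => ?_
        rw [← ofReal_measureReal (measure_ne_top _ _)]
        exact ENNReal.ofReal_le_ofReal (hBj j)
    _ = _ := by
        rw [← ENNReal.ofReal_tsum_of_nonneg (fun j => by positivity) hsum.summable, hsum.tsum_eq]

/-! ### Spectral norm of a Gaussian matrix -/

/-- Approximating the direction `y / ‖y‖` by a net point loses at most `‖y‖ / 2`, which is absorbed
on the left. -/
lemma norm_le_of_forall_inner_le {F : Type*} [NormedAddCommGroup F] [InnerProductSpace ℝ F]
    {N : Finset F} (hN : ∀ u : F, ‖u‖ ≤ 1 → ∃ n ∈ N, ‖u - n‖ ≤ 1 / 2) {y : F} {t : ℝ}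
    (ht : 0 ≤ t) (h : ∀ a ∈ N, inner ℝ a y ≤ t) : ‖y‖ ≤ 2 * t := by
  rcases eq_or_ne y 0 with rfl | hy
  · simpa using ht
  have hy' : 0 < ‖y‖ := norm_pos_iff.2 hy
  obtain ⟨a, ha, hua⟩ := hN (‖y‖⁻¹ • y) (by
    rw [norm_smul, norm_inv, norm_norm, inv_mul_cancel₀ hy'.ne'])
  have h1 : ‖y‖ = inner ℝ a y + inner ℝ (‖y‖⁻¹ • y - a) y := by
    rw [← inner_add_left, add_sub_cancel, real_inner_smul_left, real_inner_self_eq_norm_sq]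
    field_simp
  have h2 := real_inner_le_norm (‖y‖⁻¹ • y - a) y
  have h3 := h a ha
  nlinarith [mul_le_mul_of_nonneg_right hua hy'.le]

lemma opNorm_le_of_forall_inner_le {E F : Type*} [NormedAddCommGroup E] [NormedSpace ℝ E]
    [NormedAddCommGroup F] [InnerProductSpace ℝ F] {N : Finset E} {M : Finset F}
    (hN : ∀ u : E, ‖u‖ ≤ 1 → ∃ n ∈ N, ‖u - n‖ ≤ 1 / 2)
    (hM : ∀ u : F, ‖u‖ ≤ 1 → ∃ n ∈ M, ‖u - n‖ ≤ 1 / 2) (T : E →L[ℝ] F) {t : ℝ}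
    (ht : 0 ≤ t) (h : ∀ a ∈ M, ∀ n ∈ N, inner ℝ a (T n) ≤ t) : ‖T‖ ≤ 4 * t := by
  have h1 : ‖T‖ ≤ 2 * t + ‖T‖ * (1 / 2) := by
    refine T.opNorm_le_of_unit_norm (by positivity) fun u hu => ?_
    obtain ⟨n, hn, hun⟩ := hN u hu.le
    calc ‖T u‖ = ‖T n + T (u - n)‖ := by rw [← map_add, add_sub_cancel]
      _ ≤ ‖T n‖ + ‖T (u - n)‖ := norm_add_le _ _
      _ ≤ 2 * t + ‖T‖ * ‖u - n‖ := add_le_add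
          (norm_le_of_forall_inner_le hM ht fun a ha => h a ha n hn) (T.le_opNorm _)
      _ ≤ _ := by gcongr
  linarith

/-- A Gaussian matrix has spectral norm of order `√(k + d)`. -/
lemma measureReal_spectralNorm_gt_le (k d : ℕ) :
    (gaussianMatrix k d).real {w | 10 * √((k : ℝ) + d) < spectralNorm (Matrix.of w)} ≤
      Real.exp (-((k : ℝ) + d)) := by
  obtain ⟨N, hNc, hN1, hN⟩ := exists_half_net (EuclideanSpace ℝ (Fin d))
  obtain ⟨M, hMc, hM1, hM⟩ := exists_half_net (EuclideanSpace ℝ (Fin k))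
  rw [finrank_euclideanSpace_fin] at hNc hMc
  -- The factor 6 gives each net pair the tail `exp (-3(k + d))`, which beats the `5 ^ (k + d) ≤ exp
  -- (2(k + d))` pairs.
  set t : ℝ := √(6 * ((k : ℝ) + d)) with ht
  have ht4 : 4 * t ≤ 10 * √((k : ℝ) + d) := by
    rw [ht, Real.sqrt_mul (by norm_num)]
    have : √(6 : ℝ) ≤ 5 / 2 := Real.sqrt_le_iff.2 ⟨by norm_num, by norm_num⟩
    nlinarith [Real.sqrt_nonneg ((k : ℝ) + d)]
  have hsub : {w : Fin k → Fin d → ℝ | 10 * √((k : ℝ) + d) < spectralNorm (Matrix.of w)} ⊆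
      ⋃ q ∈ M ×ˢ N, {w | t ≤ ∑ l, q.1.ofLp l * (w l ⬝ᵥ q.2.ofLp)} := by
    intro w hw
    by_contra hcon
    simp only [Set.mem_iUnion, Set.mem_ofPred_eq, not_exists, not_le, Finset.mem_product] at hcon
    refine (ht4.trans_lt hw).not_ge ?_
    refine opNorm_le_of_forall_inner_le hN hM
      ((Matrix.toEuclideanLin (𝕜 := ℝ)).trans LinearMap.toContinuousLinearMap (Matrix.of w))
      (Real.sqrt_nonneg _) fun a ha n hn => ?_
    refine le_trans (le_of_eq ?_) (hcon (a, n) ⟨ha, hn⟩).le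
    simp [PiLp.inner_apply, Matrix.toLpLin_apply, Matrix.mulVec, mul_comm]
  have hdot : ∀ {m : ℕ} (x : EuclideanSpace ℝ (Fin m)), ‖x‖ ≤ 1 → x.ofLp ⬝ᵥ x.ofLp ≤ 1 := by
    intro m x hx
    have h1 : x.ofLp ⬝ᵥ x.ofLp = ‖x‖ ^ 2 := by
      rw [EuclideanSpace.real_norm_sq_eq]
      exact Finset.sum_congr rfl fun i _ => (sq _).symm
    rw [h1]
    exact pow_le_one₀ (norm_nonneg _) hx
  have hone : ∀ q ∈ M ×ˢ N, (gaussianMatrix k d).real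
      {w | t ≤ ∑ l, q.1.ofLp l * (w l ⬝ᵥ q.2.ofLp)} ≤ Real.exp (-(3 * ((k : ℝ) + d))) := by
    intro q hq
    obtain ⟨h1, h2⟩ := Finset.mem_product.1 hq
    refine ((hasSubgaussianMGF_bilinear (hdot _ (hM1 _ h1)) (hdot _ (hN1 _ h2))).measure_ge_le
      (Real.sqrt_nonneg _)).trans_eq ?_
    rw [Real.sq_sqrt (by positivity)]
    congr 1
    simp only [NNReal.coe_one]
    ring
  have hcount : ((M ×ˢ N).card : ℝ) ≤ Real.exp (2 * ((k : ℝ) + d)) := by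
    have h5 : (5 : ℝ) ≤ Real.exp 2 := by
      have := Real.quadratic_le_exp_of_nonneg (x := 2) (by norm_num)
      linarith
    have h1 : (M ×ˢ N).card ≤ 5 ^ (k + d) := by
      rw [Finset.card_product, pow_add]
      exact Nat.mul_le_mul hMc hNc
    calc ((M ×ˢ N).card : ℝ) ≤ (5 : ℝ) ^ (k + d) := by exact_mod_cast h1
      _ ≤ Real.exp 2 ^ (k + d) := by gcongr
      _ = _ := by rw [← Real.exp_nat_mul]; push_cast; ring_nf
  calc _ ≤ _ := measureReal_mono hsub (measure_ne_top _ _)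
    _ ≤ _ := measureReal_biUnion_finset_le _ _
    _ ≤ ∑ q ∈ M ×ˢ N, Real.exp (-(3 * ((k : ℝ) + d))) := Finset.sum_le_sum hone
    _ = (M ×ˢ N).card * Real.exp (-(3 * ((k : ℝ) + d))) := by
        rw [Finset.sum_const, nsmul_eq_mul]
    _ ≤ Real.exp (2 * ((k : ℝ) + d)) * Real.exp (-(3 * ((k : ℝ) + d))) := by gcongr
    _ = _ := by rw [← Real.exp_add]; congr 1; ring

/-! ### Deterministic effect of a weight perturbation -/

section Deterministic

variable {k d : ℕ}

lemma abs_sub_le_of_abs_deriv_le {φ : ℝ → ℝ} {Γ : ℝ} (hφ : Differentiable ℝ φ)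
    (h : ∀ z, |deriv φ z| ≤ Γ) (a b : ℝ) : |φ a - φ b| ≤ Γ * |a - b| :=
  convex_univ.norm_image_sub_le_of_norm_deriv_le (fun z _ => hφ z) (fun z _ => h z)
    (Set.mem_univ b) (Set.mem_univ a)

/-- Replacing `b` by `b'` costs `Γ |b - b'|`; afterwards `z ↦ φ (z + b') - φ z` has derivative at
most `Γ |b'|` because `φ'` is `Γ`-Lipschitz. -/
lemma abs_second_difference_le {φ : ℝ → ℝ} {Γ : ℝ} (hφ : Differentiable ℝ φ)
    (hφ' : Differentiable ℝ (deriv φ)) (h1 : ∀ z, |deriv φ z| ≤ Γ)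
    (h2 : ∀ z, |deriv (deriv φ) z| ≤ Γ) (a b a' b' : ℝ) :
    |φ (a + b) - φ a - (φ (a' + b') - φ a')| ≤ Γ * |b - b'| + Γ * (|a - a'| * |b'|) := by
  have h3 := abs_sub_le_of_abs_deriv_le hφ h1 (a + b) (a + b')
  have h4 : ∀ z, HasDerivAt (fun z => φ (z + b') - φ z) (deriv φ (z + b') - deriv φ z) z :=
    fun z => ((hφ (z + b')).hasDerivAt.comp_add_const z b').sub (hφ z).hasDerivAt
  have h5 := abs_sub_le_of_abs_deriv_le (φ := fun z => φ (z + b') - φ z) (Γ := Γ * |b'|)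
    (fun z => (h4 z).differentiableAt) (fun z => by
      rw [(h4 z).deriv]
      simpa using abs_sub_le_of_abs_deriv_le hφ' h2 (z + b') z) a a'
  rw [show a + b - (a + b') = b - b' by ring] at h3
  calc |φ (a + b) - φ a - (φ (a' + b') - φ a')|
      = |(φ (a + b) - φ (a + b')) + (φ (a + b') - φ a - (φ (a' + b') - φ a'))| := by
        congr 1; ring
    _ ≤ _ := abs_add_le _ _
    _ ≤ Γ * |b - b'| + Γ * |b'| * |a - a'| := add_le_add h3 h5
    _ = _ := by ring

lemma IsBalancedOutput.abs_le {v : Fin k → ℝ} (hv : IsBalancedOutput v) (l : Fin k) :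
    |v l| ≤ 1 / √(k : ℝ) := by
  have h0 : 0 ≤ 1 / √(k : ℝ) := by positivity
  by_cases h1 : v l = 1 / √(k : ℝ)
  · rw [h1, abs_of_nonneg h0]
  by_cases h2 : v l = -(1 / √(k : ℝ))
  · rw [h2, abs_neg, abs_of_nonneg h0]
  · rw [hv.eq_zero l h1 h2, abs_zero]; exact h0

lemma sum_abs_mul_abs_le (y z : EuclideanSpace ℝ (Fin k)) :
    ∑ l, |y l| * |z l| ≤ ‖y‖ * ‖z‖ := by
  rw [EuclideanSpace.norm_eq, EuclideanSpace.norm_eq]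
  exact Real.sum_mul_le_sqrt_mul_sqrt _ _ _

lemma sum_abs_le (y : EuclideanSpace ℝ (Fin k)) : ∑ l, |y l| ≤ √(k : ℝ) * ‖y‖ := by
  have h := Real.sum_mul_le_sqrt_mul_sqrt (Finset.univ : Finset (Fin k)) (fun _ => 1)
    (fun l => |y l|)
  rw [EuclideanSpace.norm_eq]
  simpa using h

lemma spectralNorm_nonneg (A : Matrix (Fin k) (Fin d) ℝ) : 0 ≤ spectralNorm A :=
  norm_nonneg ((Matrix.toEuclideanLin (𝕜 := ℝ)).trans LinearMap.toContinuousLinearMap A)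

lemma norm_mulVec_le (A : Matrix (Fin k) (Fin d) ℝ) (x : EuclideanSpace ℝ (Fin d)) :
    ‖WithLp.toLp 2 (A *ᵥ x.ofLp)‖ ≤ spectralNorm A * ‖x‖ :=
  A.l2_opNorm_mulVec x

lemma abs_network_sub_le {φ : ℝ → ℝ} {v : Fin k → ℝ} (W₀ D : Matrix (Fin k) (Fin d) ℝ)
    (x x' : EuclideanSpace ℝ (Fin d)) {M : Fin k → ℝ} (hv : IsBalancedOutput v)
    (h : ∀ l, |φ ((W₀ *ᵥ x.ofLp) l + (D *ᵥ x.ofLp) l) - φ ((W₀ *ᵥ x.ofLp) l) -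
      (φ ((W₀ *ᵥ x'.ofLp) l + (D *ᵥ x'.ofLp) l) - φ ((W₀ *ᵥ x'.ofLp) l))| ≤ M l) :
    |network φ v (W₀ + D) x - network φ v (W₀ + D) x'| ≤
      |network φ v W₀ x - network φ v W₀ x'| + 1 / √(k : ℝ) * ∑ l, M l := by
  have h1 : network φ v (W₀ + D) x - network φ v (W₀ + D) x' =
      (network φ v W₀ x - network φ v W₀ x') +
      ∑ l, v l * (φ ((W₀ *ᵥ x.ofLp) l + (D *ᵥ x.ofLp) l) - φ ((W₀ *ᵥ x.ofLp) l) -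
      (φ ((W₀ *ᵥ x'.ofLp) l + (D *ᵥ x'.ofLp) l) - φ ((W₀ *ᵥ x'.ofLp) l))) := by
    simp only [network, dotProduct, Matrix.add_mulVec, Pi.add_apply, ← Finset.sum_sub_distrib,
      ← Finset.sum_add_distrib]
    exact Finset.sum_congr rfl fun l _ => by ring
  rw [h1]
  refine (abs_add_le _ _).trans (add_le_add_right ?_ _)
  rw [Finset.mul_sum]
  refine (Finset.abs_sum_le_sum_abs _ _).trans (Finset.sum_le_sum fun l _ => ?_)
  rw [abs_mul]
  exact mul_le_mul (hv.abs_le l) (h l) (abs_nonneg _) (by positivity)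

lemma abs_network_perturbed_sub_le {φ : ℝ → ℝ} {Γ : ℝ} (hφ : Differentiable ℝ φ)
    (hφ' : Differentiable ℝ (deriv φ)) (h1 : ∀ z, |deriv φ z| ≤ Γ)
    (h2 : ∀ z, |deriv (deriv φ) z| ≤ Γ) {v : Fin k → ℝ} (hv : IsBalancedOutput v) (hk : 0 < k)
    (W₀ D : Matrix (Fin k) (Fin d) ℝ) {L : ℝ} (hL : spectralNorm W₀ ≤ L * √(k : ℝ))
    {c x x' : EuclideanSpace ℝ (Fin d)} {ε : ℝ} (hc : ‖c‖ = 1)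
    (hx : ‖x - c‖ ≤ ε) (hx' : ‖x' - c‖ ≤ ε) :
    |network φ v (W₀ + D) x - network φ v (W₀ + D) x'| ≤
      |network φ v W₀ x - network φ v W₀ x'| + (4 + 4 * L) * Γ * ε * spectralNorm D := by
  have hε : 0 ≤ ε := (norm_nonneg _).trans hx
  have hΓ : 0 ≤ Γ := (abs_nonneg _).trans (h1 0)
  have hk' : 0 < √(k : ℝ) := Real.sqrt_pos.2 (by exact_mod_cast hk)
  have hL0 : 0 ≤ L := nonneg_of_mul_nonneg_left ((spectralNorm_nonneg W₀).trans hL) hk'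
  have hD := spectralNorm_nonneg D
  have hnorm : ∀ {y : EuclideanSpace ℝ (Fin d)}, ‖y - c‖ ≤ ε → ‖y‖ ≤ 1 + ε := by
    intro y hy
    have := norm_add_le c (y - c)
    rw [add_sub_cancel, hc] at this
    linarith
  have hxx' : ‖x - x'‖ ≤ 2 * ε := by
    have := norm_sub_le (x - c) (x' - c)
    rw [sub_sub_sub_cancel_right] at this
    linarith
  -- For `ε ≥ 1` the Lipschitz bound at each point suffices, as `1 + ε ≤ 2ε`. For `ε ≤ 1` the second
  -- difference supplies the factor `ε`, and `‖x'‖ ≤ 2`.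
  rcases le_total 1 ε with h | h
  · refine (abs_network_sub_le W₀ D x x'
      (M := fun l => Γ * |(D *ᵥ x.ofLp) l| + Γ * |(D *ᵥ x'.ofLp) l|) hv fun l => ?_).trans
      (add_le_add_right ?_ _)
    · refine (abs_sub _ _).trans (add_le_add ?_ ?_)
      · simpa using abs_sub_le_of_abs_deriv_le hφ h1 ((W₀ *ᵥ x.ofLp) l + (D *ᵥ x.ofLp) l)
          ((W₀ *ᵥ x.ofLp) l)
      · simpa using abs_sub_le_of_abs_deriv_le hφ h1 ((W₀ *ᵥ x'.ofLp) l + (D *ᵥ x'.ofLp) l)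
          ((W₀ *ᵥ x'.ofLp) l)
    · rw [Finset.sum_add_distrib, ← Finset.mul_sum, ← Finset.mul_sum]
      have e1 := (sum_abs_le (WithLp.toLp 2 (D *ᵥ x.ofLp))).trans
        (mul_le_mul_of_nonneg_left ((norm_mulVec_le D x).trans
          (mul_le_mul_of_nonneg_left (hnorm hx) hD)) hk'.le)
      have e2 := (sum_abs_le (WithLp.toLp 2 (D *ᵥ x'.ofLp))).trans
        (mul_le_mul_of_nonneg_left ((norm_mulVec_le D x').trans
          (mul_le_mul_of_nonneg_left (hnorm hx') hD)) hk'.le)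
      calc 1 / √(k : ℝ) * (Γ * ∑ l, |(D *ᵥ x.ofLp) l| + Γ * ∑ l, |(D *ᵥ x'.ofLp) l|)
          ≤ 1 / √(k : ℝ) * (Γ * (√(k : ℝ) * (spectralNorm D * (1 + ε))) +
            Γ * (√(k : ℝ) * (spectralNorm D * (1 + ε)))) := by gcongr
        _ = Γ * spectralNorm D * (2 + 2 * ε) := by field_simp; ring
        _ ≤ Γ * spectralNorm D * ((4 + 4 * L) * ε) := by
          gcongr
          nlinarith
        _ = _ := by ring
  · refine (abs_network_sub_le W₀ D x x'
      (M := fun l => Γ * |(D *ᵥ x.ofLp) l - (D *ᵥ x'.ofLp) l| +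
        Γ * (|(W₀ *ᵥ x.ofLp) l - (W₀ *ᵥ x'.ofLp) l| * |(D *ᵥ x'.ofLp) l|)) hv
      fun l => abs_second_difference_le hφ hφ' h1 h2 _ _ _ _).trans (add_le_add_right ?_ _)
    rw [Finset.sum_add_distrib, ← Finset.mul_sum, ← Finset.mul_sum]
    have hsub : ∀ (A : Matrix (Fin k) (Fin d) ℝ) l,
        (A *ᵥ x.ofLp) l - (A *ᵥ x'.ofLp) l = (A *ᵥ (x - x').ofLp) l := by
      intro A l
      rw [WithLp.ofLp_sub, Matrix.mulVec_sub, Pi.sub_apply]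
    simp only [hsub]
    have e1 := (sum_abs_le (WithLp.toLp 2 (D *ᵥ (x - x').ofLp))).trans
      (mul_le_mul_of_nonneg_left ((norm_mulVec_le D (x - x')).trans
        (mul_le_mul_of_nonneg_left hxx' hD)) hk'.le)
    have e2 := (sum_abs_mul_abs_le (WithLp.toLp 2 (W₀ *ᵥ (x - x').ofLp))
      (WithLp.toLp 2 (D *ᵥ x'.ofLp))).trans
      (mul_le_mul ((norm_mulVec_le W₀ (x - x')).trans
        (mul_le_mul hL hxx' (norm_nonneg _) (by positivity)))
        ((norm_mulVec_le D x').trans (mul_le_mul_of_nonneg_left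
          ((hnorm hx').trans (by linarith : 1 + ε ≤ 2)) hD)) (norm_nonneg _) (by positivity))
    calc 1 / √(k : ℝ) * (Γ * ∑ l, |(D *ᵥ (x - x').ofLp) l| +
          Γ * ∑ l, |(W₀ *ᵥ (x - x').ofLp) l| * |(D *ᵥ x'.ofLp) l|)
        ≤ 1 / √(k : ℝ) * (Γ * (√(k : ℝ) * (spectralNorm D * (2 * ε))) +
          Γ * (L * √(k : ℝ) * (2 * ε) * (spectralNorm D * 2))) := by gcongr
      _ = (2 + 4 * L) * Γ * ε * spectralNorm D := by field_simp; ring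
      _ ≤ _ := by gcongr; norm_num

end Deterministic

/-! ### Variation of the network at initialization -/

/-- At a Gaussian initialization the network varies by at most `O(Γ ε √d)` on a ball of
radius `ε`. -/
lemma measureReal_exists_network_sub_gt_le {k d : ℕ} (hd : 0 < d) {φ : ℝ → ℝ} {Γ : ℝ}
    (hφ : Differentiable ℝ φ) (h1 : ∀ z, |deriv φ z| ≤ Γ) {v : Fin k → ℝ}
    (hv : IsBalancedOutput v) (c : EuclideanSpace ℝ (Fin d)) {ε : ℝ} (hε : 0 ≤ ε) :
    (gaussianMatrix k d).real {w | ∃ x x' : EuclideanSpace ℝ (Fin d), ‖x - c‖ ≤ ε ∧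
      ‖x' - c‖ ≤ ε ∧ 160 * (Γ * ε * √(d : ℝ)) <
        |network φ v (Matrix.of w) x - network φ v (Matrix.of w) x'|} ≤
      Real.exp (-(100 * (d : ℝ))) := by
  have hΓ : 0 ≤ Γ := (abs_nonneg _).trans (h1 0)
  have hlip := abs_sub_le_of_abs_deriv_le hφ h1
  -- Chaining needs a positive increment scale; if `Γ * ε = 0`, either `φ` is constant or the ball
  -- is a point.
  rcases (mul_nonneg hΓ hε).eq_or_lt with h0 | hpos
  · refine le_trans (measureReal_mono (s₂ := ∅) ?_) (by simpa using (Real.exp_pos _).le)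
    rintro w ⟨x, x', hx, hx', hlt⟩
    refine hlt.not_ge (le_of_eq ?_)
    rw [← h0, zero_mul, mul_zero, abs_eq_zero, sub_eq_zero]
    rcases mul_eq_zero.1 h0.symm with h | h
    · have hconst : ∀ a b, φ a = φ b := fun a b => by
        have := hlip a b
        rw [h, zero_mul] at this
        exact sub_eq_zero.1 (abs_nonpos_iff.1 this)
      simp only [network, dotProduct]
      exact Finset.sum_congr rfl fun l _ => congrArg (v l * ·) (hconst _ _)
    · rw [h] at hx hx'
      rw [sub_eq_zero.1 (norm_le_zero_iff.1 hx), sub_eq_zero.1 (norm_le_zero_iff.1 hx')]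
  have hε' : 0 < ε := pos_of_mul_pos_right hpos hΓ
  let X : EuclideanSpace ℝ (Fin d) → (Fin k → Fin d → ℝ) → ℝ :=
    fun u w => network φ v (Matrix.of w) (c + ε • u)
  have hX : ∀ w, Continuous fun u => X u w := by
    intro w
    have := hφ.continuous
    simp only [X, network, dotProduct, Matrix.mulVec]
    fun_prop
  have hinc : ∀ (u u' : EuclideanSpace ℝ (Fin d)) (s : NNReal),
      (Γ * ε * ‖u - u'‖) ^ 2 ≤ s →
      HasSubgaussianMGF (fun w => X u w - X u' w) s (gaussianMatrix k d) := by
    intro u u' s hs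
    have e1 : (fun w => X u w - X u' w) = fun w : Fin k → Fin d → ℝ =>
        ∑ l, v l * (φ (w l ⬝ᵥ (c + ε • u).ofLp) - φ (w l ⬝ᵥ (c + ε • u').ofLp)) := by
      ext w
      simp only [mul_sub, Finset.sum_sub_distrib]
      rfl
    rw [e1]
    refine hv.hasSubgaussianMGF (x := (ε • (u - u')).ofLp) (b := Γ)
      (Y := fun g => φ (g ⬝ᵥ (c + ε • u).ofLp) - φ (g ⬝ᵥ (c + ε • u').ofLp)) ?_ (fun g => ?_) ?_
    · have := hφ.continuous
      refine Continuous.measurable ?_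
      simp only [dotProduct]
      fun_prop
    · refine (hlip _ _).trans_eq ?_
      rw [← dotProduct_sub, ← WithLp.ofLp_sub, add_sub_add_left_eq_sub, smul_sub]
    · have e2 : (ε • (u - u')).ofLp ⬝ᵥ (ε • (u - u')).ofLp = ‖ε • (u - u')‖ ^ 2 := by
        rw [EuclideanSpace.real_norm_sq_eq]
        exact Finset.sum_congr rfl fun i _ => (sq _).symm
      rw [e2, norm_smul, Real.norm_eq_abs, abs_of_pos hε']
      refine le_trans (le_of_eq ?_) hs
      ring
  refine (measureReal_mono ?_ (measure_ne_top _ _)).trans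
    (measureReal_exists_abs_sub_gt_le hd hX hpos hinc)
  rintro w ⟨x, x', hx, hx', hlt⟩
  by_contra hcon
  simp only [Set.mem_ofPred_eq, not_exists, not_and, not_lt] at hcon
  -- Both points are compared with the centre, so the chaining constant 80 doubles to 160.
  have hball : ∀ y : EuclideanSpace ℝ (Fin d), ‖y - c‖ ≤ ε →
      |network φ v (Matrix.of w) y - X 0 w| ≤ 80 * (Γ * ε * √(d : ℝ)) := by
    intro y hy
    have e3 := hcon (ε⁻¹ • (y - c)) (by
      rw [norm_smul, norm_inv, Real.norm_eq_abs, abs_of_pos hε', inv_mul_le_iff₀ hε', mul_one]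
      exact hy)
    have e4 : c + ε • ε⁻¹ • (y - c) = y := by
      rw [smul_smul, mul_inv_cancel₀ hε'.ne', one_smul, add_sub_cancel]
    simp only [X, e4] at e3 ⊢
    exact e3
  have e5 := hball x hx
  have e6 := hball x' hx'
  have e7 := abs_sub_le (network φ v (Matrix.of w) x) (X 0 w) (network φ v (Matrix.of w) x')
  rw [abs_sub_comm (X 0 w)] at e7
  linarith

end ShallowNet

/-! ### Union bound and conclusion -/

theorem mainTheorem8 (c₁ c₂ : ℝ) (hc₁ : 0 < c₁) (hc₂ : 0 < c₂) :
    ∃ C : ℝ, 0 < C ∧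
      ∀ (d k K : ℕ), c₁ * (d : ℝ) ≤ (k : ℝ) →
      ∀ (Γ : ℝ) (φ : ℝ → ℝ), Differentiable ℝ φ → Differentiable ℝ (deriv φ) →
        (∀ z, |deriv φ z| ≤ Γ) → (∀ z, |deriv (deriv φ) z| ≤ Γ) →
      ∀ v : Fin k → ℝ, ShallowNet.IsBalancedOutput v →
      ∀ cluster : Fin K → EuclideanSpace ℝ (Fin d), (∀ i, ‖cluster i‖ = 1) →
      ∀ ε₀ : ℝ, 0 ≤ ε₀ →
      ∀ (Ω : Type*) [MeasurableSpace Ω] (P : Measure Ω) [IsProbabilityMeasure P]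
        (W₀ : Ω → Matrix (Fin k) (Fin d) ℝ), ShallowNet.IsGaussianMatrix W₀ P →
        1 - 2 * Real.exp (-((k : ℝ) + (d : ℝ))) - (K : ℝ) * Real.exp (-(100 * (d : ℝ))) ≤
          P.real {ω | ∀ W : Matrix (Fin k) (Fin d) ℝ,
            ShallowNet.frobeniusNorm (W - W₀ ω) ≤ c₂ * √(k : ℝ) →
            ∀ (i : Fin K) (x x' : EuclideanSpace ℝ (Fin d)),
              ‖x - cluster i‖ ≤ ε₀ → ‖x' - cluster i‖ ≤ ε₀ →
              |ShallowNet.network φ v W x - ShallowNet.network φ v W x'| ≤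
                C * Γ * ε₀ * (ShallowNet.spectralNorm (W - W₀ ω) + √(d : ℝ))} := by
  -- Since `k + d ≤ (1 + 1 / c₁) k`, this `L` turns `10 √(k + d)` into `L √k`. In the final
  -- constant, 160 comes from chaining and `4 * L` from the perturbation, whose remaining 4 fits
  -- inside 160.
  set L : ℝ := 10 * √(1 + 1 / c₁) with hL
  refine ⟨160 + 4 * L, by positivity, ?_⟩
  intro d k K hkd Γ φ hφ hφ' h1 h2 v hv cluster hcl ε₀ hε Ω _ P _ W₀ hW₀
  -- Without centres the claim is vacuous; with one, a unit vector exists, which forces `d > 0` and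
  -- then `k > 0`.
  rcases Nat.eq_zero_or_pos K with rfl | hK
  · have huniv : {ω | ∀ W : Matrix (Fin k) (Fin d) ℝ,
        ShallowNet.frobeniusNorm (W - W₀ ω) ≤ c₂ * √(k : ℝ) →
        ∀ (i : Fin 0) (x x' : EuclideanSpace ℝ (Fin d)),
          ‖x - cluster i‖ ≤ ε₀ → ‖x' - cluster i‖ ≤ ε₀ →
          |ShallowNet.network φ v W x - ShallowNet.network φ v W x'| ≤
            (160 + 4 * L) * Γ * ε₀ * (ShallowNet.spectralNorm (W - W₀ ω) + √(d : ℝ))} =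
        Set.univ := Set.eq_univ_of_forall fun ω W _ i => i.elim0
    rw [huniv, probReal_univ]
    have := Real.exp_pos (-((k : ℝ) + d))
    simp only [Nat.cast_zero, zero_mul, sub_zero]
    linarith
  have hd : 0 < d := by
    rcases Nat.eq_zero_or_pos d with rfl | hd
    · have := hcl ⟨0, hK⟩
      rw [Subsingleton.elim (cluster ⟨0, hK⟩) 0, norm_zero] at this
      exact absurd this zero_ne_one
    · exact hd
  have hd' : (0 : ℝ) < d := by exact_mod_cast hd
  have hk' : (0 : ℝ) < k := (mul_pos hc₁ hd').trans_le hkd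
  have hk : 0 < k := by exact_mod_cast hk'
  have hΓ : 0 ≤ Γ := (abs_nonneg _).trans (h1 0)
  obtain ⟨hmeas, hmap⟩ := hW₀.map_eq
  have hLk : 10 * √((k : ℝ) + d) ≤ L * √(k : ℝ) := by
    rw [hL, mul_assoc, ← Real.sqrt_mul (by positivity)]
    gcongr
    have : (d : ℝ) ≤ k / c₁ := by rw [le_div_iff₀ hc₁]; linarith
    calc (k : ℝ) + d ≤ k + k / c₁ := by gcongr
      _ = _ := by ring
  set S := {ω | ∀ W : Matrix (Fin k) (Fin d) ℝ,
            ShallowNet.frobeniusNorm (W - W₀ ω) ≤ c₂ * √(k : ℝ) →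
            ∀ (i : Fin K) (x x' : EuclideanSpace ℝ (Fin d)),
              ‖x - cluster i‖ ≤ ε₀ → ‖x' - cluster i‖ ≤ ε₀ →
              |ShallowNet.network φ v W x - ShallowNet.network φ v W x'| ≤
                (160 + 4 * L) * Γ * ε₀ * (ShallowNet.spectralNorm (W - W₀ ω) + √(d : ℝ))} with hS
  let B₀ : Set (Fin k → Fin d → ℝ) :=
    {w | 10 * √((k : ℝ) + d) < ShallowNet.spectralNorm (Matrix.of w)}
  let B : Fin K → Set (Fin k → Fin d → ℝ) := fun i =>
    {w | ∃ x x' : EuclideanSpace ℝ (Fin d), ‖x - cluster i‖ ≤ ε₀ ∧ ‖x' - cluster i‖ ≤ ε₀ ∧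
      160 * (Γ * ε₀ * √(d : ℝ)) < |ShallowNet.network φ v (Matrix.of w) x -
        ShallowNet.network φ v (Matrix.of w) x'|}
  have hsub : Sᶜ ⊆ (fun ω l j => W₀ ω l j) ⁻¹' (B₀ ∪ ⋃ i, B i) := by
    intro ω hω
    by_contra hcon
    refine hω fun W _ i x x' hx hx' => ?_
    simp only [Set.mem_preimage, Set.mem_union, Set.mem_iUnion, not_or, not_exists, B₀, B,
      Set.mem_ofPred_eq, not_lt, not_and] at hcon
    obtain ⟨hc0, hc1⟩ := hcon
    have e1 := hc1 i x x' hx hx'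
    have e2 := ShallowNet.abs_network_perturbed_sub_le hφ hφ' h1 h2 hv hk (W₀ ω) (W - W₀ ω)
      (hc0.trans hLk) (hcl i) hx hx'
    rw [add_sub_cancel] at e2
    refine e2.trans ((add_le_add_left e1 _).trans ?_)
    have e3 := ShallowNet.spectralNorm_nonneg (W - W₀ ω)
    have e4 : 0 ≤ Γ * ε₀ * √(d : ℝ) := by positivity
    have e5 : 0 ≤ Γ * ε₀ * ShallowNet.spectralNorm (W - W₀ ω) := by positivity
    have e6 : 0 ≤ L := by positivity
    nlinarith [mul_nonneg e6 e4]
  have hbad : P.real Sᶜ ≤ Real.exp (-((k : ℝ) + d)) + K * Real.exp (-(100 * (d : ℝ))) := by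
    calc P.real Sᶜ ≤ P.real ((fun ω l j => W₀ ω l j) ⁻¹' (B₀ ∪ ⋃ i, B i)) :=
          measureReal_mono hsub
      _ ≤ (ShallowNet.gaussianMatrix k d).real (B₀ ∪ ⋃ i, B i) := by
          rw [← hmap]
          have := Measure.isProbabilityMeasure_map hmeas
          -- This inequality for preimages holds for arbitrary sets, so the bad events need not be
          -- shown measurable.
          exact ENNReal.toReal_mono (measure_ne_top _ _) (Measure.le_map_apply hmeas _)
      _ ≤ (ShallowNet.gaussianMatrix k d).real B₀ +
          (ShallowNet.gaussianMatrix k d).real (⋃ i, B i) := measureReal_union_le _ _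
      _ ≤ Real.exp (-((k : ℝ) + d)) + ∑ i : Fin K, Real.exp (-(100 * (d : ℝ))) :=
          add_le_add (ShallowNet.measureReal_spectralNorm_gt_le k d)
            ((measureReal_iUnion_fintype_le _).trans (Finset.sum_le_sum fun i _ =>
              ShallowNet.measureReal_exists_network_sub_gt_le hd hφ h1 hv (cluster i) hε))
      _ = _ := by simp
  -- Subadditivity suffices in place of the complement rule, so measurability of `S` is not needed.
  have htot : 1 ≤ P.real S + P.real Sᶜ := by
    rw [← probReal_univ (μ := P), ← Set.union_compl_self S]
    exact measureReal_union_le _ _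
  have := Real.exp_pos (-((k : ℝ) + d))
  linarith
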